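/- Let $F$ be a real Banach lattice and $\mu\in F^{*}$. Let $|\mu|$ be the modulus of $\mu$ in the Banach lattice $F^{*}$ (so $|\mu|=\mu$ if $\mu\ge 0$), and let $\|f\|_{\mu}:=|\mu|(|f|)$ for $f\in F$, which is a continuous seminorm on $F$. Let $L_{1}(\mu)$ be the completion of the quotient $F/\ker\|\cdot\|_{\mu}$ with respect to the norm induced by $\|\cdot\|_\mu$, and let $J_{\mu}:F\to L_{1}(\mu)$ be the canonical map. Let $F^{*}_{a}=(F^*)_a$ be the order continuous part of $F^{*}$, i.e. the largest order ideal of $F^{*}$ on which the dual norm is order continuous. Then the following conditions are equivalent: (i) $\mu\in F^{*}_{a}$; (ii) the topology induced by $\|\cdot\|_{\mu}$ is boundedly exhaustive, i.e. every norm-bounded disjoint sequence in $F$ converges to $0$ in it; (iii) for every Banach space $H$ and every bounded operator $T:F\to H$ such that $T\oplus J_{\mu}:F\to H\oplus L_{1}(\mu)$, $f\mapsto (Tf,J_\mu f)$, is bounded below, $T$ is disjointly non-singular (DNS), i.e. for no disjoint sequence of nonzero vectors is the restriction of $T$ to its closed span strictly singular (not bounded below on any infinite-dimensional subspace); (iv)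 every closed subspace $E\subset F$ with quotient map $Q_{E}:F\to F/E$, such that $Q_{E}\oplus J_{\mu}$ is bounded below, is dispersed, i.e. there are no sequence $(e_{n})$ of norm-one vectors in $E$ and disjoint sequence $(f_{n})$ in $F$ with $\|f_{n}-e_{n}\|\to 0$; (v) $J_{\mu}$ is disjointly strictly singular, i.e. it is not bounded below on the closed span of any disjoint sequence of nonzero vectors. Moreover, the same five conditions are equivalent if $J_{\mu}$ is replaced by any bounded lattice homomorphism $J:F\to L_{1}(\Omega,m)$ into the $L_{1}$-space of a measure space $(\Omega,m)$ such that $\int_{\Omega} Jf\,dm=|\mu|(f)$ for every $f\in F$. -/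

import Mathlib

open Filter Topology MeasureTheory

universe u v

noncomputable section

namespace BanachLattice

/-! ### The dual of a Banach lattice as a vector lattice -/

section Dual

variable {F : Type u} [NormedAddCommGroup F] [Lattice F] [HasSolidNorm F] [IsOrderedAddMonoid F]
  [NormedSpace ℝ F]

/-- The usual order of the dual: `φ ≤ ψ` iff `φ f ≤ ψ f` for all `f ≥ 0`. -/
instance dualPartialOrder : PartialOrder (StrongDual ℝ F) where
  le φ ψ := ∀ f : F, 0 ≤ f → φ f ≤ ψ f
  le_refl _ _ _ := le_rfl
  le_trans _ _ _ h₁ h₂ f hf := (h₁ f hf).trans (h₂ f hf)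
  le_antisymm φ ψ h₁ h₂ := by
    ext f
    rw [← posPart_sub_negPart f, map_sub, map_sub,
      le_antisymm (h₁ _ (posPart_nonneg f)) (h₂ _ (posPart_nonneg f)),
      le_antisymm (h₁ _ (negPart_nonneg f)) (h₂ _ (negPart_nonneg f))]

theorem dual_le_def (φ ψ : StrongDual ℝ F) : φ ≤ ψ ↔ ∀ f : F, 0 ≤ f → φ f ≤ ψ f := Iff.rfl

instance dualIsOrderedAddMonoid : IsOrderedAddMonoid (StrongDual ℝ F) where
  add_le_add_left φ ψ h χ f hf := by
    simpa using h f hf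

/-- The Riesz-Kantorovich formula on the positive cone: `sup {φ g : 0 ≤ g ≤ f}`. -/
def coneSup (φ : StrongDual ℝ F) (f : F) : ℝ := sSup (φ '' Set.Icc 0 f)

theorem apply_le_of_mem (φ : StrongDual ℝ F) {f g : F} (hg : g ∈ Set.Icc 0 f) :
    φ g ≤ ‖φ‖ * ‖f‖ := by
  have h : ‖g‖ ≤ ‖f‖ := HasSolidNorm.solid (by
    rw [abs_of_nonneg hg.1, abs_of_nonneg (hg.1.trans hg.2)]; exact hg.2)
  calc φ g ≤ ‖φ g‖ := Real.le_norm_self _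
    _ ≤ ‖φ‖ * ‖g‖ := φ.le_opNorm g
    _ ≤ ‖φ‖ * ‖f‖ := by gcongr

theorem bddAbove_image (φ : StrongDual ℝ F) (f : F) : BddAbove (φ '' Set.Icc 0 f) := by
  refine ⟨‖φ‖ * ‖f‖, ?_⟩
  rintro _ ⟨g, hg, rfl⟩
  exact apply_le_of_mem φ hg

theorem le_coneSup (φ : StrongDual ℝ F) {f g : F} (hg : 0 ≤ g) (hgf : g ≤ f) :
    φ g ≤ coneSup φ f :=
  le_csSup (bddAbove_image φ f) ⟨g, ⟨hg, hgf⟩, rfl⟩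

theorem coneSup_le (φ : StrongDual ℝ F) {f : F} (hf : 0 ≤ f) {r : ℝ}
    (h : ∀ g, 0 ≤ g → g ≤ f → φ g ≤ r) : coneSup φ f ≤ r := by
  refine csSup_le ⟨_, 0, ⟨le_rfl, hf⟩, rfl⟩ ?_
  rintro _ ⟨g, hg, rfl⟩
  exact h g hg.1 hg.2

theorem coneSup_nonneg (φ : StrongDual ℝ F) {f : F} (hf : 0 ≤ f) : 0 ≤ coneSup φ f := by
  simpa using le_coneSup φ le_rfl hf

theorem coneSup_le_norm (φ : StrongDual ℝ F) {f : F} (hf : 0 ≤ f) :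
    coneSup φ f ≤ ‖φ‖ * ‖f‖ :=
  coneSup_le φ hf fun _ h₁ h₂ => apply_le_of_mem φ ⟨h₁, h₂⟩

theorem coneSup_add (φ : StrongDual ℝ F) {f g : F} (hf : 0 ≤ f) (hg : 0 ≤ g) :
    coneSup φ (f + g) = coneSup φ f + coneSup φ g := by
  apply le_antisymm
  · refine coneSup_le φ (add_nonneg hf hg) fun h h₀ h₁ => ?_
    have e : h = h ⊓ f + (h - h ⊓ f) := by abel
    rw [e, map_add]
    refine add_le_add (le_coneSup φ (le_inf h₀ hf) inf_le_right)
      (le_coneSup φ (sub_nonneg.2 inf_le_left) ?_)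
    rw [sub_le_iff_le_add', ← sub_le_iff_le_add]
    exact le_inf (sub_le_self _ hg) (sub_le_iff_le_add.2 h₁)
  · rw [← le_sub_iff_add_le]
    refine coneSup_le φ hf fun a a₀ a₁ => ?_
    rw [le_sub_iff_add_le, ← le_sub_iff_add_le']
    refine coneSup_le φ hg fun b b₀ b₁ => ?_
    rw [le_sub_iff_add_le', ← map_add]
    exact le_coneSup φ (add_nonneg a₀ b₀) (add_le_add a₁ b₁)

theorem coneSup_posPart_sub_negPart (φ : StrongDual ℝ F) {f a b : F} (ha : 0 ≤ a) (hb : 0 ≤ b)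
    (hf : f = a - b) : coneSup φ f⁺ - coneSup φ f⁻ = coneSup φ a - coneSup φ b := by
  have e : f⁺ + b = a + f⁻ := by
    have := posPart_sub_negPart f
    rw [hf] at this ⊢
    rw [← sub_eq_zero]
    rw [← sub_eq_zero] at this
    rw [← this]
    abel
  have := congrArg (coneSup φ) e
  rw [coneSup_add φ (posPart_nonneg f) hb, coneSup_add φ ha (negPart_nonneg f)] at this
  linarith

/-- The positive part `φ⁺ = φ ⊔ 0` of a functional, extended linearly from the positive cone. -/
def dualPos (φ : StrongDual ℝ F) : StrongDual ℝ F :=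
  AddMonoidHom.toRealLinearMap
    { toFun := fun f => coneSup φ f⁺ - coneSup φ f⁻
      map_zero' := by simp
      map_add' := fun f g => by
        rw [coneSup_posPart_sub_negPart φ (add_nonneg (posPart_nonneg f) (posPart_nonneg g))
          (add_nonneg (negPart_nonneg f) (negPart_nonneg g)) (f := f + g) (by
            conv_lhs => rw [← posPart_sub_negPart f, ← posPart_sub_negPart g]
            abel),
          coneSup_add φ (posPart_nonneg f) (posPart_nonneg g),
          coneSup_add φ (negPart_nonneg f) (negPart_nonneg g)]
        ring }
    (AddMonoidHomClass.continuous_of_bound _ ‖φ‖ fun f => by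
      have h₁ := coneSup_le_norm φ (posPart_nonneg f)
      have h₂ := coneSup_le_norm φ (negPart_nonneg f)
      have h₃ := coneSup_nonneg φ (posPart_nonneg f)
      have h₄ := coneSup_nonneg φ (negPart_nonneg f)
      have n₁ : ‖f⁺‖ ≤ ‖f‖ := HasSolidNorm.solid (by
        rw [abs_of_nonneg (posPart_nonneg f), ← posPart_add_negPart]
        exact le_add_of_nonneg_right (negPart_nonneg f))
      have n₂ : ‖f⁻‖ ≤ ‖f‖ := HasSolidNorm.solid (by
        rw [abs_of_nonneg (negPart_nonneg f), ← posPart_add_negPart]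
        exact le_add_of_nonneg_left (posPart_nonneg f))
      have m₁ := mul_le_mul_of_nonneg_left n₁ (norm_nonneg φ)
      have m₂ := mul_le_mul_of_nonneg_left n₂ (norm_nonneg φ)
      simp only [AddMonoidHom.coe_mk, ZeroHom.coe_mk, Real.norm_eq_abs]
      rw [abs_le]
      constructor <;> linarith)

theorem dualPos_apply (φ : StrongDual ℝ F) {f : F} (hf : 0 ≤ f) :
    dualPos φ f = coneSup φ f := by
  have h := coneSup_posPart_sub_negPart φ hf le_rfl (f := f) (by simp)
  have h₀ : coneSup φ 0 = 0 :=
    le_antisymm (by simpa using coneSup_le_norm φ (le_refl (0 : F))) (coneSup_nonneg φ le_rfl)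
  rw [h₀, sub_zero] at h
  exact h

/-- The dual of a Banach lattice is a lattice for the usual order. -/
instance dualLattice : Lattice (StrongDual ℝ F) where
  __ := dualPartialOrder
  sup φ ψ := φ + dualPos (ψ - φ)
  inf φ ψ := φ - dualPos (φ - ψ)
  le_sup_left φ ψ f hf := by
    rw [_root_.add_apply, dualPos_apply _ hf]
    linarith [coneSup_nonneg (ψ - φ) hf]
  le_sup_right φ ψ f hf := by
    rw [_root_.add_apply, dualPos_apply _ hf]
    have := le_coneSup (ψ - φ) hf le_rfl
    rw [_root_.sub_apply] at this
    linarith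
  sup_le φ ψ χ h₁ h₂ f hf := by
    rw [_root_.add_apply, dualPos_apply _ hf]
    have : coneSup (ψ - φ) f ≤ χ f - φ f := coneSup_le _ hf fun g g₀ g₁ => by
      have a := h₁ (f - g) (sub_nonneg.2 g₁)
      have b := h₂ g g₀
      rw [map_sub, map_sub] at a
      rw [_root_.sub_apply]
      linarith
    linarith
  inf_le_left φ ψ f hf := by
    rw [_root_.sub_apply, dualPos_apply _ hf]
    linarith [coneSup_nonneg (φ - ψ) hf]
  inf_le_right φ ψ f hf := by
    rw [_root_.sub_apply, dualPos_apply _ hf]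
    have := le_coneSup (φ - ψ) hf le_rfl
    rw [_root_.sub_apply] at this
    linarith
  le_inf χ φ ψ h₁ h₂ f hf := by
    rw [_root_.sub_apply, dualPos_apply _ hf]
    have : coneSup (φ - ψ) f ≤ φ f - χ f := coneSup_le _ hf fun g g₀ g₁ => by
      have a := h₁ (f - g) (sub_nonneg.2 g₁)
      have b := h₂ g g₀
      rw [map_sub, map_sub] at a
      rw [_root_.sub_apply]
      linarith
    linarith

theorem dual_apply_nonneg {φ : StrongDual ℝ F} (hφ : 0 ≤ φ) {f : F} (hf : 0 ≤ f) : 0 ≤ φ f := by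
  simpa using hφ f hf

theorem dual_apply_mono {φ : StrongDual ℝ F} (hφ : 0 ≤ φ) {f g : F} (h : f ≤ g) :
    φ f ≤ φ g := by
  have := dual_apply_nonneg hφ (sub_nonneg.2 h)
  rw [map_sub] at this
  linarith

end Dual

/-! ### The order continuous part of a Banach lattice -/

section OrderContinuousPart

variable {X : Type u} [NormedAddCommGroup X] [Lattice X] [NormedSpace ℝ X]

/-- The norm is order continuous on the ideal `I`: every set in `I` that is directed downwards
and has infimum `0` in `I` contains elements of arbitrarily small norm. (For a decreasing net of
positive elements this says that the net converges to `0` in norm.) -/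
def OrderContinuousNormOn (I : Submodule ℝ X) : Prop :=
  ∀ D : Set I, D.Nonempty → DirectedOn (· ≥ ·) D → IsGLB D 0 →
    ∀ ε : ℝ, 0 < ε → ∃ x ∈ D, ‖x‖ < ε

variable (X) in
/-- The order continuous part of `X`: the largest order ideal of `X` on which the norm is order
continuous, as the union of all such ideals. -/
def orderContinuousPart : Set X :=
  {x | ∃ I : Submodule ℝ X, LatticeOrderedAddCommGroup.IsSolid (I : Set X) ∧
    OrderContinuousNormOn I ∧ x ∈ I}

end OrderContinuousPart

/-! ### Disjoint sequences, exhaustive topologies, dispersed subspaces -/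

section Disjoint

variable {F : Type u} [NormedAddCommGroup F] [Lattice F]

/-- A sequence of pairwise disjoint elements: `|f m| ∧ |f n| = 0` for `m ≠ n`. -/
def DisjointSeq (f : ℕ → F) : Prop := Pairwise fun m n => |f m| ⊓ |f n| = 0

/-- Every norm-bounded disjoint sequence is `τ`-null. -/
def BoundedlyExhaustive (τ : TopologicalSpace F) : Prop :=
  ∀ f : ℕ → F, DisjointSeq f → Bornology.IsBounded (Set.range f) → Tendsto f atTop (@nhds F τ 0)

variable [NormedSpace ℝ F]

/-- `E` contains no almost disjoint sequence. -/
def Dispersed (E : Submodule ℝ F) : Prop :=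
  ¬ ∃ e f : ℕ → F, (∀ n, e n ∈ E ∧ ‖e n‖ = 1) ∧ DisjointSeq f ∧
    Tendsto (fun n => ‖f n - e n‖) atTop (𝓝 0)

/-- The closed linear span of a sequence. -/
def closedSpan (f : ℕ → F) : Submodule ℝ F := (Submodule.span ℝ (Set.range f)).topologicalClosure

end Disjoint

/-! ### Classes of operators -/

section Operators

/-- `‖T x‖ ≥ c ‖x‖` for some `c > 0`. -/
def BoundedBelow {X : Type u} {Y : Type v} [SeminormedAddCommGroup X] [NormedSpace ℝ X]
    [SeminormedAddCommGroup Y] [NormedSpace ℝ Y] (T : X →L[ℝ] Y) : Prop :=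
  ∃ c : ℝ, 0 < c ∧ ∀ x, c * ‖x‖ ≤ ‖T x‖

/-- Not bounded below on any infinite-dimensional subspace. -/
def StrictlySingular {X : Type u} {Y : Type v} [NormedAddCommGroup X] [NormedSpace ℝ X]
    [NormedAddCommGroup Y] [NormedSpace ℝ Y] (T : X →L[ℝ] Y) : Prop :=
  ∀ G : Submodule ℝ X, ¬ FiniteDimensional ℝ G → ¬ BoundedBelow (T.comp G.subtypeL)

variable {F : Type u} [NormedAddCommGroup F] [Lattice F] [NormedSpace ℝ F]
  {H : Type v} [NormedAddCommGroup H] [NormedSpace ℝ H]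

/-- Disjointly non-singular: the restriction to the closed span of any disjoint sequence
(of nonzero vectors) is not strictly singular. -/
def DNS (T : F →L[ℝ] H) : Prop :=
  ∀ f : ℕ → F, DisjointSeq f → (∀ n, f n ≠ 0) →
    ¬ StrictlySingular (T.comp (closedSpan f).subtypeL)

/-- Disjointly strictly singular: not bounded below on the closed span of any disjoint sequence
(of nonzero vectors). -/
def DSS (T : F →L[ℝ] H) : Prop :=
  ∀ f : ℕ → F, DisjointSeq f → (∀ n, f n ≠ 0) →
    ¬ BoundedBelow (T.comp (closedSpan f).subtypeL)

end Operators

/-! ### The AL-space `L₁(μ)` and the homomorphism `J_μ` -/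

section AL

variable {F : Type u} [NormedAddCommGroup F] [Lattice F] [HasSolidNorm F] [IsOrderedAddMonoid F]
  [NormedSpace ℝ F] [IsOrderedModule ℝ F]

theorem abs_real_smul (a : ℝ) (f : F) : |a • f| = |a| • |f| := by
  have key : ∀ (b : ℝ) (g : F), 0 ≤ b → |b • g| ≤ b • |g| := fun b g hb =>
    abs_le'.2 ⟨smul_le_smul_of_nonneg_left (le_abs_self g) hb, by
      rw [← smul_neg]; exact smul_le_smul_of_nonneg_left (neg_le_abs g) hb⟩
  have pos : ∀ (b : ℝ) (g : F), 0 ≤ b → |b • g| = b • |g| := fun b g hb => by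
    rcases hb.eq_or_lt with rfl | hb'
    · simp
    · refine le_antisymm (key b g hb) ?_
      have := smul_le_smul_of_nonneg_left (key b⁻¹ (b • g) (inv_nonneg.2 hb)) hb
      rwa [smul_smul, smul_smul, inv_mul_cancel₀ hb'.ne', mul_inv_cancel₀ hb'.ne', one_smul,
        one_smul] at this
  rcases le_total 0 a with ha | ha
  · rw [abs_of_nonneg ha, pos a f ha]
  · rw [abs_of_nonpos ha, ← pos (-a) f (neg_nonneg.2 ha), neg_smul, abs_neg]

/-- The AL seminorm `‖f‖_μ = |μ|(|f|)`. -/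
def alSeminorm (μ : StrongDual ℝ F) : Seminorm ℝ F :=
  Seminorm.of (fun f => |μ| |f|)
    (fun f g => by
      rw [← map_add]
      exact dual_apply_mono (abs_nonneg μ) (abs_add_le f g))
    (fun a f => by rw [abs_real_smul, map_smul, smul_eq_mul, Real.norm_eq_abs])

theorem alSeminorm_apply (μ : StrongDual ℝ F) (f : F) : alSeminorm μ f = |μ| |f| := rfl

/-- For a positive functional, `‖f‖_μ = μ(|f|)`. -/
theorem alSeminorm_apply_of_nonneg {μ : StrongDual ℝ F} (hμ : 0 ≤ μ) (f : F) :
    alSeminorm μ f = μ |f| := by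
  rw [alSeminorm_apply, abs_of_nonneg hμ]

/-- The topology on `F` induced by `‖·‖_μ`. -/
abbrev alTopology (μ : StrongDual ℝ F) : TopologicalSpace F :=
  (alSeminorm μ).toSeminormedAddCommGroup.toUniformSpace.toTopologicalSpace

/-- `F` with the seminorm `‖·‖_μ` in place of its norm. -/
def PreL1 (_ : StrongDual ℝ F) : Type u := F

instance (μ : StrongDual ℝ F) : AddCommGroup (PreL1 μ) := inferInstanceAs (AddCommGroup F)

instance (μ : StrongDual ℝ F) : Module ℝ (PreL1 μ) := inferInstanceAs (Module ℝ F)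

instance (μ : StrongDual ℝ F) : SeminormedAddCommGroup (PreL1 μ) :=
  AddGroupSeminorm.toSeminormedAddCommGroup (E := PreL1 μ) (alSeminorm μ).toAddGroupSeminorm

instance (μ : StrongDual ℝ F) : NormedSpace ℝ (PreL1 μ) where
  __ := (inferInstance : Module ℝ (PreL1 μ))
  norm_smul_le a f := (map_smul_eq_mul (alSeminorm μ) a f).le

/-- `L₁(μ)`: the completion of the quotient of `F` by the kernel of `‖·‖_μ`
(`UniformSpace.Completion` is the Hausdorff completion). -/
abbrev L1 (μ : StrongDual ℝ F) : Type u := UniformSpace.Completion (PreL1 μ)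

/-- The identity map `(F, ‖·‖) → (F, ‖·‖_μ)`. -/
def toPreL1 (μ : StrongDual ℝ F) : F →L[ℝ] PreL1 μ :=
  LinearMap.mkContinuous
    { toFun := fun f => f
      map_add' := fun _ _ => rfl
      map_smul' := fun _ _ => rfl } ‖|μ|‖ fun f => by
    change |μ| |f| ≤ _
    rw [← norm_abs_eq_norm f]
    exact (Real.le_norm_self _).trans (|μ|.le_opNorm _)

/-- The canonical map `J_μ : F → L₁(μ)`. -/
def J (μ : StrongDual ℝ F) : F →L[ℝ] L1 μ := UniformSpace.Completion.toComplL.comp (toPreL1 μ)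

theorem norm_J (μ : StrongDual ℝ F) (f : F) : ‖J μ f‖ = |μ| |f| :=
  UniformSpace.Completion.norm_coe (toPreL1 μ f)

end AL

end BanachLattice

end

/-! Everything passes through `NullOnDisjoint μ`, which is (ii) with the topology unfolded.

For (i), suppose `μ` lies in an ideal with order continuous norm. Restricting `|μ|` to the tails of
a disjoint sequence gives functionals in that ideal which decrease to zero, hence tend to zero in
norm (`nullOnDisjoint_of_mem_orderContinuousPart`). Conversely, the functionals null on bounded
disjoint sequences form a solid ideal. For each of them, the positive part of the unit ball lies
below a single `u` up to a small excess (`NullOnDisjoint.exists_posPart_le`), so pointwise decrease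
to zero at `u` forces decrease in norm.

For (iii)-(v) only `‖J f‖ = |μ| |f|` matters. If `μ` is null, `J` tends to zero along normalized
disjoint sequences, so it cannot supply a lower bound there. If not, some normalized disjoint
sequence has `|μ| |f n| ≥ δ`. Then `J` is bounded below on its closed span `E`, as in `ℓ₁`, and `E`
with its quotient map refutes (iii), (iv) and (v). -/

namespace BanachLattice

/-! ### Disjointness in lattice-ordered groups -/

section LatticeGroup

variable {G : Type*} [AddCommGroup G] [Lattice G] [IsOrderedAddMonoid G]

/-- With `z` the left side, `z - z ⊓ b = z ⊔ b - b`, which is at most `c` since both `z` and `b` lie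
below `b + c`. -/
theorem inf_add_le_inf_add_inf {a b c : G} (ha : 0 ≤ a) (hb : 0 ≤ b) (hc : 0 ≤ c) :
    a ⊓ (b + c) ≤ a ⊓ b + a ⊓ c := by
  set z := a ⊓ (b + c) with hz
  have h₁ : z ≤ z ⊓ b + c := by
    have h : z ⊔ b ≤ b + c := sup_le inf_le_right (le_add_of_nonneg_right hc)
    have e : z + b = z ⊓ b + z ⊔ b := (inf_add_sup z b).symm
    have : z + b ≤ z ⊓ b + c + b := by
      rw [e, add_assoc, add_comm c b]
      exact add_le_add_right h _
    exact le_of_add_le_add_right this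
  have h₂ : z ≤ z ⊓ b + a :=
    inf_le_left.trans (le_add_of_nonneg_left (le_inf (le_inf ha (add_nonneg hb hc)) hb))
  have h₃ : z - z ⊓ b ≤ a ⊓ c := le_inf (sub_le_iff_le_add'.2 h₂) (sub_le_iff_le_add'.2 h₁)
  calc z = z ⊓ b + (z - z ⊓ b) := by abel
    _ ≤ a ⊓ b + a ⊓ c := add_le_add (inf_le_inf_right b inf_le_left) h₃

theorem inf_add_eq_zero {a b c : G} (ha : 0 ≤ a) (hb : 0 ≤ b) (hc : 0 ≤ c)
    (hab : a ⊓ b = 0) (hac : a ⊓ c = 0) : a ⊓ (b + c) = 0 :=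
  le_antisymm (by simpa [hab, hac] using inf_add_le_inf_add_inf ha hb hc)
    (le_inf ha (add_nonneg hb hc))

theorem inf_sum_eq_zero {ι : Type*} {a : G} (ha : 0 ≤ a) (s : Finset ι) {b : ι → G}
    (hb : ∀ i ∈ s, 0 ≤ b i) (h : ∀ i ∈ s, a ⊓ b i = 0) : a ⊓ ∑ i ∈ s, b i = 0 := by
  classical
  induction s using Finset.induction_on with
  | empty => simpa using ha
  | insert i s hi ih =>
    rw [Finset.sum_insert hi]
    exact inf_add_eq_zero ha (hb i (by simp))
      (Finset.sum_nonneg fun j hj => hb j (Finset.mem_insert_of_mem hj)) (h i (by simp))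
      (ih (fun j hj => hb j (Finset.mem_insert_of_mem hj))
        fun j hj => h j (Finset.mem_insert_of_mem hj))

theorem inf_nsmul_eq_zero {a b : G} (ha : 0 ≤ a) (hb : 0 ≤ b) (h : a ⊓ b = 0) (n : ℕ) :
    a ⊓ n • b = 0 := by
  simpa using inf_sum_eq_zero ha (Finset.range n) (b := fun _ => b) (fun _ _ => hb) fun _ _ => h

theorem inf_eq_zero_of_le {a b c d : G} (ha : 0 ≤ a) (hb : 0 ≤ b) (hac : a ≤ c) (hbd : b ≤ d)
    (h : c ⊓ d = 0) : a ⊓ b = 0 :=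
  le_antisymm (h ▸ inf_le_inf hac hbd) (le_inf ha hb)

theorem add_eq_sup_of_inf_eq_zero {a b : G} (h : a ⊓ b = 0) : a + b = a ⊔ b := by
  rw [← inf_add_sup a b, h, zero_add]

theorem abs_le_abs_add_of_inf_eq_zero {x y : G} (h : |x| ⊓ |y| = 0) : |x| ≤ |x + y| := by
  have h₁ : |x| ≤ |x + y| + |y| := by
    simpa [abs_neg] using abs_add_le (x + y) (-y)
  calc |x| = |x| ⊓ (|x + y| + |y|) := (inf_eq_left.2 h₁).symm
    _ ≤ |x| ⊓ |x + y| + |x| ⊓ |y| :=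
      inf_add_le_inf_add_inf (abs_nonneg _) (abs_nonneg _) (abs_nonneg _)
    _ = |x| ⊓ |x + y| := by rw [h, add_zero]
    _ ≤ |x + y| := inf_le_right

theorem abs_add_of_inf_eq_zero {x y : G} (h : |x| ⊓ |y| = 0) : |x + y| = |x| + |y| := by
  refine le_antisymm (abs_add_le x y) ?_
  rw [add_eq_sup_of_inf_eq_zero h]
  refine sup_le (abs_le_abs_add_of_inf_eq_zero h) ?_
  rw [add_comm]
  exact abs_le_abs_add_of_inf_eq_zero (by rwa [inf_comm])

theorem abs_sum_of_pairwise_disjoint {ι : Type*} (s : Finset ι) {g : ι → G}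
    (h : Pairwise fun i j => |g i| ⊓ |g j| = 0) : |∑ i ∈ s, g i| = ∑ i ∈ s, |g i| := by
  classical
  induction s using Finset.induction_on with
  | empty => simp
  | insert i s hi ih =>
    rw [Finset.sum_insert hi, Finset.sum_insert hi, ← ih, abs_add_of_inf_eq_zero]
    rw [ih]
    exact inf_sum_eq_zero (abs_nonneg _) s (fun _ _ => abs_nonneg _) fun j hj =>
      h fun hij => hi (hij ▸ hj)

end LatticeGroup

/-! ### Disjoint sequences and their closed spans -/

section DisjointSeq

variable {F : Type u} [NormedAddCommGroup F] [Lattice F]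

theorem DisjointSeq.comp {f : ℕ → F} (hf : DisjointSeq f) {k : ℕ → ℕ}
    (hk : Function.Injective k) : DisjointSeq (f ∘ k) := fun _ _ h => hf (hk.ne h)

variable [HasSolidNorm F] [IsOrderedAddMonoid F] [NormedSpace ℝ F] [IsOrderedModule ℝ F]

/-- Real multiples are dominated by natural ones, for which disjointness follows from additivity. -/
theorem DisjointSeq.smul {f : ℕ → F} (hf : DisjointSeq f) (a : ℕ → ℝ) :
    DisjointSeq fun n => a n • f n := fun m n h => by
  have le : ∀ k, ∃ j : ℕ, |a k • f k| ≤ j • |f k| := fun k => by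
    obtain ⟨j, hj⟩ := exists_nat_ge |a k|
    refine ⟨j, ?_⟩
    rw [abs_real_smul, ← Nat.cast_smul_eq_nsmul ℝ]
    exact smul_le_smul_of_nonneg_right hj (abs_nonneg _)
  obtain ⟨i, hi⟩ := le m
  obtain ⟨j, hj⟩ := le n
  refine inf_eq_zero_of_le (abs_nonneg _) (abs_nonneg _) hi hj ?_
  refine inf_nsmul_eq_zero (nsmul_nonneg (abs_nonneg _) i) (abs_nonneg _) ?_ j
  rw [inf_comm]
  exact inf_nsmul_eq_zero (abs_nonneg _) (abs_nonneg _) (by rw [inf_comm]; exact hf h) i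

theorem DisjointSeq.abs_sum {f : ℕ → F} (hf : DisjointSeq f) (s : Finset ℕ) (a : ℕ → ℝ) :
    |∑ i ∈ s, a i • f i| = ∑ i ∈ s, |a i| • |f i| := by
  rw [abs_sum_of_pairwise_disjoint s (hf.smul a)]
  simp_rw [abs_real_smul]

/-- The modulus of a disjoint sum dominates that of each summand, so the coordinates are controlled
by the norm. -/
theorem DisjointSeq.abs_mul_norm_le {f : ℕ → F} (hf : DisjointSeq f) (s : Finset ℕ)
    (a : ℕ → ℝ) {i : ℕ} (hi : i ∈ s) : |a i| * ‖f i‖ ≤ ‖∑ i ∈ s, a i • f i‖ := by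
  rw [← Real.norm_eq_abs, ← norm_smul]
  refine norm_le_norm_of_abs_le_abs ?_
  rw [hf.abs_sum, abs_real_smul]
  exact Finset.single_le_sum (f := fun i => |a i| • |f i|)
    (fun j _ => smul_nonneg (abs_nonneg _) (abs_nonneg _)) hi

theorem DisjointSeq.linearIndependent {f : ℕ → F} (hf : DisjointSeq f) (h0 : ∀ n, f n ≠ 0) :
    LinearIndependent ℝ f := by
  rw [linearIndependent_iff']
  intro s a h i hi
  have := hf.abs_mul_norm_le s a hi
  rw [h, norm_zero] at this
  have h' : 0 < ‖f i‖ := norm_pos_iff.2 (h0 i)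
  have : |a i| ≤ 0 := nonpos_of_mul_nonpos_left this h'
  exact abs_nonpos_iff.1 this

theorem exists_eq_sum_of_mem_span {f : ℕ → F} {x : F}
    (hx : x ∈ Submodule.span ℝ (Set.range f)) :
    ∃ (s : Finset ℕ) (a : ℕ → ℝ), x = ∑ i ∈ s, a i • f i := by
  obtain ⟨c, rfl⟩ := Finsupp.mem_span_range_iff_exists_finsupp.1 hx
  exact ⟨c.support, c, rfl⟩

theorem mem_closedSpan (f : ℕ → F) (n : ℕ) : f n ∈ closedSpan f :=
  Submodule.le_topologicalClosure _ (Submodule.subset_span ⟨n, rfl⟩)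

theorem le_norm_of_mem_closedSpan {Y : Type*} [SeminormedAddCommGroup Y] [NormedSpace ℝ Y]
    (T : F →L[ℝ] Y) {f : ℕ → F} {c : ℝ}
    (h : ∀ (s : Finset ℕ) (a : ℕ → ℝ), c * ‖∑ i ∈ s, a i • f i‖ ≤ ‖T (∑ i ∈ s, a i • f i)‖)
    {x : F} (hx : x ∈ closedSpan f) : c * ‖x‖ ≤ ‖T x‖ := by
  have hcl : IsClosed {x : F | c * ‖x‖ ≤ ‖T x‖} :=
    isClosed_le (by fun_prop) (by fun_prop)
  have hsub : (Submodule.span ℝ (Set.range f) : Set F) ⊆ {x : F | c * ‖x‖ ≤ ‖T x‖} := by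
    intro x hx
    obtain ⟨s, a, rfl⟩ := exists_eq_sum_of_mem_span hx
    exact h s a
  exact closure_minimal hsub hcl hx

end DisjointSeq

/-! ### Positive functionals and nullity on disjoint sequences -/

section Functionals

variable {F : Type u} [NormedAddCommGroup F] [Lattice F] [HasSolidNorm F] [IsOrderedAddMonoid F]
  [NormedSpace ℝ F]

theorem norm_le_norm_of_nonneg_of_le {f g : F} (hf : 0 ≤ f) (h : f ≤ g) : ‖f‖ ≤ ‖g‖ :=
  norm_le_norm_of_abs_le_abs (by rwa [abs_of_nonneg hf, abs_of_nonneg (hf.trans h)])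

/-- Kantorovich extension: additivity makes `p a - p b` depend only on `a - b`. Homogeneity need not
be assumed, because a continuous additive map is real linear. -/
theorem exists_dual_eq_on_cone (p : F → ℝ) (C : ℝ) (h0 : ∀ f, 0 ≤ f → 0 ≤ p f)
    (hC : ∀ f, 0 ≤ f → p f ≤ C * ‖f‖)
    (hadd : ∀ f g, 0 ≤ f → 0 ≤ g → p (f + g) = p f + p g) :
    ∃ φ : StrongDual ℝ F, ∀ f, 0 ≤ f → φ f = p f := by
  have hdiff : ∀ f a b : F, 0 ≤ a → 0 ≤ b → f = a - b → p f⁺ - p f⁻ = p a - p b := by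
    intro f a b ha hb hf
    have e : f⁺ + b = a + f⁻ := by
      have h := posPart_sub_negPart f
      nth_rewrite 3 [hf] at h
      exact sub_eq_sub_iff_add_eq_add.1 h
    have := congrArg p e
    rw [hadd _ _ (posPart_nonneg f) hb, hadd _ _ ha (negPart_nonneg f)] at this
    linarith
  have hzero : p 0 = 0 := by simpa using hadd 0 0 le_rfl le_rfl
  refine ⟨AddMonoidHom.toRealLinearMap
    { toFun := fun f => p f⁺ - p f⁻
      map_zero' := by simp
      map_add' := fun f g => by
        rw [hdiff (f + g) (f⁺ + g⁺) (f⁻ + g⁻)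
          (add_nonneg (posPart_nonneg f) (posPart_nonneg g))
          (add_nonneg (negPart_nonneg f) (negPart_nonneg g)) (by
            conv_lhs => rw [← posPart_sub_negPart f, ← posPart_sub_negPart g]
            abel),
          hadd _ _ (posPart_nonneg f) (posPart_nonneg g),
          hadd _ _ (negPart_nonneg f) (negPart_nonneg g)]
        ring }
    (AddMonoidHomClass.continuous_of_bound _ |C| fun f => ?_), fun f hf => ?_⟩
  · have hb : ∀ g : F, 0 ≤ g → g ≤ |f| → p g ≤ |C| * ‖f‖ := fun g hg hgf =>
      (hC g hg).trans (mul_le_mul (le_abs_self C)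
        (by rw [← norm_abs_eq_norm f]; exact norm_le_norm_of_nonneg_of_le hg hgf)
        (norm_nonneg _) (abs_nonneg C))
    have h₁ := hb _ (posPart_nonneg f)
      (by rw [← posPart_add_negPart]; exact le_add_of_nonneg_right (negPart_nonneg f))
    have h₂ := hb _ (negPart_nonneg f)
      (by rw [← posPart_add_negPart]; exact le_add_of_nonneg_left (posPart_nonneg f))
    have h₃ := h0 _ (posPart_nonneg f)
    have h₄ := h0 _ (negPart_nonneg f)
    simp only [AddMonoidHom.coe_mk, ZeroHom.coe_mk, Real.norm_eq_abs]
    rw [abs_le]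
    constructor <;> linarith
  · change p f⁺ - p f⁻ = p f
    rw [hdiff f f 0 hf le_rfl (by simp), hzero, sub_zero]

theorem abs_dual_apply_le {φ : StrongDual ℝ F} (hφ : 0 ≤ φ) (f : F) : |φ f| ≤ φ |f| :=
  abs_le'.2 ⟨dual_apply_mono hφ (le_abs_self f), by
    rw [← map_neg]; exact dual_apply_mono hφ (neg_le_abs f)⟩

theorem abs_apply_le_abs_dual_apply (φ : StrongDual ℝ F) {f : F} (hf : 0 ≤ f) :
    |φ f| ≤ |φ| f :=
  abs_le'.2 ⟨le_abs_self φ f hf, neg_le_abs φ f hf⟩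

theorem dual_norm_le_of_nonneg {φ : StrongDual ℝ F} (hφ : 0 ≤ φ) {C : ℝ} (hC : 0 ≤ C)
    (h : ∀ f, 0 ≤ f → φ f ≤ C * ‖f‖) : ‖φ‖ ≤ C :=
  φ.opNorm_le_bound hC fun f => by
    rw [← norm_abs_eq_norm f]
    exact (abs_dual_apply_le hφ f).trans (h _ (abs_nonneg f))

theorem abs_dual_smul_le (a : ℝ) (φ : StrongDual ℝ F) : |a • φ| ≤ |a| • |φ| := by
  refine abs_le'.2 ⟨fun f hf => ?_, fun f hf => ?_⟩ <;>
    have h := abs_apply_le_abs_dual_apply φ hf <;>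
    have h' : |a * φ f| ≤ |a| * |φ| f := by
      rw [abs_mul]; exact mul_le_mul_of_nonneg_left h (abs_nonneg a)
  · exact (le_abs_self _).trans h'
  · exact (neg_le_abs _).trans h'

/-- The restriction of a positive functional to the band generated by an ideal with positive
cone `A`. -/
theorem exists_dual_restrict {φ : StrongDual ℝ F} (hφ : 0 ≤ φ) (A : Set F)
    (h0 : (0 : F) ∈ A) (hadd : ∀ a ∈ A, ∀ b ∈ A, a + b ∈ A)
    (hsolid : ∀ a ∈ A, ∀ b, 0 ≤ b → b ≤ a → b ∈ A) :
    ∃ ψ : StrongDual ℝ F, ∀ f, 0 ≤ f →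
      IsLUB (φ '' {g | g ∈ A ∧ 0 ≤ g ∧ g ≤ f}) (ψ f) := by
  set S : F → Set ℝ := fun f => φ '' {g | g ∈ A ∧ 0 ≤ g ∧ g ≤ f} with hS
  have lub : ∀ f, 0 ≤ f → IsLUB (S f) (sSup (S f)) := fun f hf =>
    isLUB_csSup ⟨_, 0, ⟨h0, le_rfl, hf⟩, rfl⟩ ⟨φ f, by
      rintro _ ⟨g, hg, rfl⟩
      exact dual_apply_mono hφ hg.2.2⟩
  obtain ⟨ψ, hψ⟩ := exists_dual_eq_on_cone (fun f => sSup (S f)) ‖φ‖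
    (fun f hf => (lub f hf).1 ⟨0, ⟨h0, le_rfl, hf⟩, map_zero φ⟩)
    (fun f hf => (lub f hf).2 (by
      rintro _ ⟨g, hg, rfl⟩
      exact apply_le_of_mem φ hg.2))
    (fun f g hf hg => by
      apply le_antisymm
      · refine (lub _ (add_nonneg hf hg)).2 ?_
        -- Riesz decomposition: `h` splits into a piece below `f` and a piece below `g`, and
        -- solidity keeps both in `A`.
        rintro _ ⟨h, ⟨hA, h₀, h₁⟩, rfl⟩
        have e : h = h ⊓ f + (h - h ⊓ f) := by abel
        have p₁ : 0 ≤ h ⊓ f := le_inf h₀ hf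
        have p₂ : 0 ≤ h - h ⊓ f := sub_nonneg.2 inf_le_left
        rw [e, map_add]
        refine add_le_add ((lub f hf).1 ⟨_, ⟨hsolid h hA _ p₁ inf_le_left, p₁, inf_le_right⟩, rfl⟩)
          ((lub g hg).1 ⟨_, ⟨hsolid h hA _ p₂ (sub_le_self _ p₁), p₂, ?_⟩, rfl⟩)
        rw [sub_le_iff_le_add', ← sub_le_iff_le_add]
        exact le_inf (sub_le_self _ hg) (sub_le_iff_le_add.2 h₁)
      · rw [← le_sub_iff_add_le]
        refine (lub f hf).2 ?_
        rintro _ ⟨a, ⟨aA, a₀, a₁⟩, rfl⟩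
        rw [le_sub_iff_add_le, ← le_sub_iff_add_le']
        refine (lub g hg).2 ?_
        rintro _ ⟨b, ⟨bA, b₀, b₁⟩, rfl⟩
        rw [le_sub_iff_add_le', ← map_add]
        exact (lub _ (add_nonneg hf hg)).1
          ⟨_, ⟨hadd a aA b bA, add_nonneg a₀ b₀, add_le_add a₁ b₁⟩, rfl⟩)
  exact ⟨ψ, fun f hf => by rw [hψ f hf]; exact lub f hf⟩

/-- The pointwise infimum of a downwards directed set of positive functionals. -/
theorem exists_dual_pointwise_inf {D : Set (StrongDual ℝ F)} (hne : D.Nonempty)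
    (hdir : DirectedOn (· ≥ ·) D) (hpos : ∀ φ ∈ D, 0 ≤ φ) :
    ∃ ψ : StrongDual ℝ F, ∀ f, 0 ≤ f → IsGLB ((fun φ : StrongDual ℝ F => φ f) '' D) (ψ f) := by
  set S : F → Set ℝ := fun f => (fun φ : StrongDual ℝ F => φ f) '' D with hS
  obtain ⟨φ₀, hφ₀⟩ := hne
  have glb : ∀ f, 0 ≤ f → IsGLB (S f) (sInf (S f)) := fun f hf =>
    isGLB_csInf ⟨_, φ₀, hφ₀, rfl⟩ ⟨0, by
      rintro _ ⟨φ, hφ, rfl⟩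
      exact dual_apply_nonneg (hpos φ hφ) hf⟩
  obtain ⟨ψ, hψ⟩ := exists_dual_eq_on_cone (fun f => sInf (S f)) ‖φ₀‖
    (fun f hf => (glb f hf).2 (by
      rintro _ ⟨φ, hφ, rfl⟩
      exact dual_apply_nonneg (hpos φ hφ) hf))
    (fun f hf => ((glb f hf).1 ⟨φ₀, hφ₀, rfl⟩).trans
      (apply_le_of_mem φ₀ (Set.right_mem_Icc.2 hf)))
    (fun f g hf hg => by
      apply le_antisymm
      · rw [← sub_le_iff_le_add]
        refine (glb f hf).2 ?_
        rintro _ ⟨φ, hφ, rfl⟩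
        change _ ≤ φ f
        rw [sub_le_iff_le_add, ← sub_le_iff_le_add']
        refine (glb g hg).2 ?_
        rintro _ ⟨χ, hχ, rfl⟩
        change _ ≤ χ g
        rw [sub_le_iff_le_add']
        -- Directedness lets a single functional undercut `φ` at `f` and `χ` at `g` simultaneously.
        obtain ⟨θ, hθ, h₁, h₂⟩ := hdir φ hφ χ hχ
        refine ((glb _ (add_nonneg hf hg)).1 ⟨θ, hθ, rfl⟩).trans ?_
        change θ (f + g) ≤ _
        rw [map_add]
        exact add_le_add (h₁ f hf) (h₂ g hg)
      · refine (glb _ (add_nonneg hf hg)).2 ?_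
        rintro _ ⟨φ, hφ, rfl⟩
        change _ ≤ φ (f + g)
        rw [map_add]
        exact add_le_add ((glb f hf).1 ⟨φ, hφ, rfl⟩) ((glb g hg).1 ⟨φ, hφ, rfl⟩))
  exact ⟨ψ, fun f hf => by rw [hψ f hf]; exact glb f hf⟩

/-- `|φ| |f n| → 0` for every norm-bounded disjoint sequence `f`. -/
def NullOnDisjoint (φ : StrongDual ℝ F) : Prop :=
  ∀ f : ℕ → F, DisjointSeq f → Bornology.IsBounded (Set.range f) →
    Tendsto (fun n => |φ| |f n|) atTop (𝓝 0)

variable (F) in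
/-- The order ideal of functionals that are null on bounded disjoint sequences. -/
def nullOnDisjointIdeal : Submodule ℝ (StrongDual ℝ F) where
  carrier := {φ | NullOnDisjoint φ}
  zero_mem' := fun f _ _ => by simp
  add_mem' := fun {φ ψ} hφ hψ f hf hb => by
    refine squeeze_zero (fun n => dual_apply_nonneg (abs_nonneg _) (abs_nonneg _))
      (fun n => abs_add_le φ ψ _ (abs_nonneg (f n))) ?_
    simpa using (hφ f hf hb).add (hψ f hf hb)
  smul_mem' := fun a φ hφ f hf hb => by
    refine squeeze_zero (fun n => dual_apply_nonneg (abs_nonneg _) (abs_nonneg _))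
      (fun n => abs_dual_smul_le a φ _ (abs_nonneg (f n))) ?_
    simpa using (hφ f hf hb).const_mul |a|

theorem isSolid_nullOnDisjointIdeal :
    LatticeOrderedAddCommGroup.IsSolid (nullOnDisjointIdeal F : Set (StrongDual ℝ F)) :=
  fun _ hφ _ hψ f hf hb =>
    squeeze_zero (fun _ => dual_apply_nonneg (abs_nonneg _) (abs_nonneg _))
      (fun n => hψ _ (abs_nonneg (f n))) (hφ f hf hb)

/-- Let `ψ n` be the part of `|μ|` carried by the tail of `f` from `n` on. These lie in `I` by
solidity and decrease to zero, so `|μ| |f n| ≤ ψ n |f n| ≤ ψ N |f n| ≤ ‖ψ N‖ * ‖f n‖` for `n ≥ N`,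
with `‖ψ N‖` small. -/
theorem nullOnDisjoint_of_mem_orderContinuousPart {μ : StrongDual ℝ F}
    (hμ : μ ∈ orderContinuousPart (StrongDual ℝ F)) : NullOnDisjoint μ := by
  obtain ⟨I, hsol, hoc, hI⟩ := hμ
  intro f hf hb
  -- The positive cone of the ideal generated by the tail from `n` on.
  set A : ℕ → Set F := fun n =>
    {y | 0 ≤ y ∧ ∃ N k : ℕ, y ≤ k • ∑ i ∈ Finset.Ico n N, |f i|} with hA
  have snn : ∀ s : Finset ℕ, 0 ≤ ∑ i ∈ s, |f i| := fun s =>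
    Finset.sum_nonneg fun i _ => abs_nonneg _
  have hex : ∀ n, ∃ ψ : StrongDual ℝ F, ∀ g, 0 ≤ g →
      IsLUB ((|μ| : StrongDual ℝ F) '' {y | y ∈ A n ∧ 0 ≤ y ∧ y ≤ g}) (ψ g) := by
    intro n
    refine exists_dual_restrict (abs_nonneg μ) (A n) ⟨le_rfl, 0, 0, by simp⟩ ?_ ?_
    · rintro a ⟨a₀, N, k, ha⟩ b ⟨b₀, M, l, hb⟩
      refine ⟨add_nonneg a₀ b₀, max N M, k + l, ?_⟩
      rw [add_smul]
      refine add_le_add (ha.trans (nsmul_le_nsmul_right ?_ k))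
        (hb.trans (nsmul_le_nsmul_right ?_ l)) <;>
      exact Finset.sum_le_sum_of_subset_of_nonneg (Finset.Ico_subset_Ico_right (by simp))
        fun i _ _ => abs_nonneg _
    · rintro a ⟨-, N, k, ha⟩ b b₀ hba
      exact ⟨b₀, N, k, hba.trans ha⟩
  choose ψ hψ using hex
  have Amono : ∀ {m n}, m ≤ n → A n ⊆ A m := fun {m n} hmn y ⟨y₀, N, k, hy⟩ =>
    ⟨y₀, N, k, hy.trans (nsmul_le_nsmul_right (Finset.sum_le_sum_of_subset_of_nonneg
      (Finset.Ico_subset_Ico_left hmn) fun i _ _ => abs_nonneg _) k)⟩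
  have ψanti : ∀ {m n}, m ≤ n → ψ n ≤ ψ m := fun {m n} hmn g hg =>
    (hψ n g hg).2 fun _ ⟨y, hy, e⟩ => (hψ m g hg).1 ⟨y, ⟨Amono hmn hy.1, hy.2⟩, e⟩
  have ψnn : ∀ n, 0 ≤ ψ n := fun n g hg =>
    (hψ n g hg).1 ⟨0, ⟨⟨le_rfl, 0, 0, by simp⟩, le_rfl, hg⟩, map_zero _⟩
  have ψle : ∀ n, ψ n ≤ |μ| := fun n g hg => (hψ n g hg).2 (by
    rintro _ ⟨y, hy, rfl⟩
    exact dual_apply_mono (abs_nonneg μ) hy.2.2)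
  have ψI : ∀ n, ψ n ∈ I := fun n => hsol hI (by rw [abs_of_nonneg (ψnn n)]; exact ψle n)
  have ψf : ∀ n, |μ| |f n| ≤ ψ n |f n| := fun n =>
    (hψ n _ (abs_nonneg _)).1 ⟨_, ⟨⟨abs_nonneg _, n + 1, 1, by simp⟩, abs_nonneg _, le_rfl⟩, rfl⟩
  have ψlim : ∀ g, 0 ≤ g → ∀ δ : ℝ, 0 < δ → ∃ n, ψ n g ≤ δ := by
    intro g hg δ hδ
    -- `y` attains `ψ 0 g` up to `δ` and involves only indices below `N`. Any `z` competing for `ψ N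
    -- g` is disjoint from `y`, so `y + z = y ⊔ z ≤ g` competes for `ψ 0 g`, leaving at most `δ` for
    -- `z`.
    obtain ⟨_, ⟨y, ⟨⟨y₀, N, k, hyk⟩, -, hyg⟩, rfl⟩, hy, -⟩ :=
      (hψ 0 g hg).exists_between (sub_lt_self _ hδ)
    refine ⟨N, (hψ N g hg).2 ?_⟩
    rintro _ ⟨z, ⟨⟨z₀, M, l, hzl⟩, -, hzg⟩, rfl⟩
    have disj : y ⊓ z = 0 := by
      refine inf_eq_zero_of_le y₀ z₀ hyk hzl ?_
      refine inf_nsmul_eq_zero (nsmul_nonneg (snn _) _) (snn _) ?_ l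
      refine inf_sum_eq_zero (nsmul_nonneg (snn _) _) _ (fun _ _ => abs_nonneg _) fun j hj => ?_
      rw [inf_comm]
      refine inf_nsmul_eq_zero (abs_nonneg _) (snn _) ?_ k
      refine inf_sum_eq_zero (abs_nonneg _) _ (fun _ _ => abs_nonneg _) fun i hi => hf ?_
      simp only [Finset.mem_Ico] at hi hj
      omega
    have hyz : y + z ≤ g := by
      rw [add_eq_sup_of_inf_eq_zero disj]; exact sup_le hyg hzg
    have hyzA : y + z ∈ A 0 := by
      obtain ⟨-, M', l', hz'⟩ := Amono (Nat.zero_le N) ⟨z₀, M, l, hzl⟩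
      refine ⟨add_nonneg y₀ z₀, max N M', k + l', ?_⟩
      rw [add_smul]
      refine add_le_add (hyk.trans (nsmul_le_nsmul_right ?_ k))
        (hz'.trans (nsmul_le_nsmul_right ?_ l')) <;>
      exact Finset.sum_le_sum_of_subset_of_nonneg (Finset.Ico_subset_Ico_right (by simp))
        fun i _ _ => abs_nonneg _
    have := (hψ 0 g hg).1 ⟨y + z, ⟨hyzA, add_nonneg y₀ z₀, hyz⟩, rfl⟩
    rw [map_add] at this
    linarith
  have hnorm : ∀ ε : ℝ, 0 < ε → ∃ n, ‖ψ n‖ < ε := by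
    intro ε hε
    obtain ⟨_, ⟨n, rfl⟩, hn⟩ := hoc (Set.range fun n => (⟨ψ n, ψI n⟩ : I)) ⟨_, 0, rfl⟩
      (by
        rintro _ ⟨m, rfl⟩ _ ⟨n, rfl⟩
        exact ⟨_, ⟨max m n, rfl⟩, ψanti (le_max_left _ _), ψanti (le_max_right _ _)⟩)
      ⟨by rintro _ ⟨n, rfl⟩; exact ψnn n, fun χ hχ g hg => by
        refine le_of_forall_pos_le_add fun δ hδ => ?_
        obtain ⟨n, hn⟩ := ψlim g hg δ hδ
        have := (hχ ⟨n, rfl⟩ : (χ : StrongDual ℝ F) ≤ ψ n) g hg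
        simpa using this.trans hn⟩ ε hε
    exact ⟨n, hn⟩
  obtain ⟨C, hC⟩ := hb.exists_norm_le
  have hC' : ∀ n, ‖f n‖ ≤ C := fun n => hC _ ⟨n, rfl⟩
  have C0 : 0 ≤ C := (norm_nonneg _).trans (hC' 0)
  rw [Metric.tendsto_atTop]
  intro ε hε
  -- `C + 1` rather than `C`, which may be zero.
  obtain ⟨N, hN⟩ := hnorm (ε / (C + 1)) (by positivity)
  refine ⟨N, fun n hn => ?_⟩
  have nn : 0 ≤ |μ| |f n| := dual_apply_nonneg (abs_nonneg _) (abs_nonneg _)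
  rw [Real.dist_0_eq_abs, abs_of_nonneg nn]
  calc |μ| |f n| ≤ ψ n |f n| := ψf n
    _ ≤ ψ N |f n| := ψanti hn _ (abs_nonneg _)
    _ ≤ ‖ψ N‖ * ‖|f n|‖ := apply_le_of_mem _ (Set.right_mem_Icc.2 (abs_nonneg _))
    _ ≤ ‖ψ N‖ * (C + 1) := by
      rw [norm_abs_eq_norm]
      exact mul_le_mul_of_nonneg_left ((hC' n).trans (by linarith)) (norm_nonneg _)
    _ < ε := by rwa [lt_div_iff₀ (by linarith)] at hN

end Functionals

/-! ### Almost order boundedness and order continuity of the dual norm -/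

section AlmostOrderBounded

variable {F : Type u} [NormedAddCommGroup F] [Lattice F] [HasSolidNorm F] [IsOrderedAddMonoid F]
  [NormedSpace ℝ F] [IsOrderedModule ℝ F] [CompleteSpace F]

/-- Since `b ≥ a⁻¹`, `y - b • x ≤ a⁻¹ • (a • y - x) ≤ (x - a • y)⁻`, and the last is disjoint from
`(x - a • y)⁺`. -/
theorem posPart_sub_smul_inf_eq_zero {x y : F} {a b : ℝ} (ha : 1 ≤ a) (hab : 1 ≤ a * b)
    (hx : 0 ≤ x) : (x - a • y)⁺ ⊓ (y - b • x)⁺ = 0 := by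
  have ha0 : 0 < a := by linarith
  refine inf_eq_zero_of_le (posPart_nonneg _) (posPart_nonneg _) le_rfl (sup_le ?_
    (negPart_nonneg (x - a • y))) (posPart_inf_negPart_eq_zero _)
  have h₁ : y - b • x ≤ a⁻¹ • (-(x - a • y)) := by
    rw [neg_sub, smul_sub, smul_smul, inv_mul_cancel₀ ha0.ne', one_smul]
    refine sub_le_sub_left (smul_le_smul_of_nonneg_right ?_ hx) _
    rw [inv_le_iff_one_le_mul₀ ha0, mul_comm]
    exact hab
  refine h₁.trans ?_
  calc a⁻¹ • (-(x - a • y)) ≤ a⁻¹ • (x - a • y)⁻ :=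
        smul_le_smul_of_nonneg_left (neg_le_negPart _) (by positivity)
    _ ≤ (1 : ℝ) • (x - a • y)⁻ :=
        smul_le_smul_of_nonneg_right (inv_le_one_of_one_le₀ ha) (negPart_nonneg _)
    _ = _ := one_smul _ _

/-- The unit ball is almost order bounded with respect to a positive functional that is null on
bounded disjoint sequences. -/
theorem NullOnDisjoint.exists_posPart_le {φ : StrongDual ℝ F} (hφ : NullOnDisjoint φ)
    {ε : ℝ} (hε : 0 < ε) :
    ∃ u : F, 0 ≤ u ∧ ∀ f, 0 ≤ f → ‖f‖ ≤ 1 → |φ| (f - u)⁺ ≤ ε := by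
  by_contra! hcon
  have hcon' : ∀ u : F, ∃ f : F, 0 ≤ u → 0 ≤ f ∧ ‖f‖ ≤ 1 ∧ ε < |φ| (f - u)⁺ := by
    intro u
    by_cases hu : 0 ≤ u
    · obtain ⟨f, hf⟩ := hcon u hu
      exact ⟨f, fun _ => hf⟩
    · exact ⟨0, fun h => absurd h hu⟩
  choose g hg using hcon'
  -- Greedy choice: `f n` violates the bound for `u = 4 ^ n • S n`, where `S n` is the sum of its
  -- predecessors.
  let S : ℕ → F := fun n => Nat.rec 0 (fun k s => s + g ((4 : ℝ) ^ k • s)) n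
  let f : ℕ → F := fun n => g ((4 : ℝ) ^ n • S n)
  have S_succ : ∀ n, S (n + 1) = S n + f n := fun n => rfl
  have S_nonneg : ∀ n, 0 ≤ S n := by
    intro n
    induction n with
    | zero => exact le_rfl
    | succ n ih =>
      rw [S_succ]
      exact add_nonneg ih (hg _ (smul_nonneg (by positivity) ih)).1
  have hf : ∀ n, 0 ≤ f n ∧ ‖f n‖ ≤ 1 ∧ ε < |φ| (f n - (4 : ℝ) ^ n • S n)⁺ := fun n =>
    hg _ (smul_nonneg (by positivity) (S_nonneg n))
  have S_mono : Monotone S := monotone_nat_of_le_succ fun n => by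
    rw [S_succ]; exact le_add_of_nonneg_right (hf n).1
  have f_le_S : ∀ {m n}, m < n → f m ≤ S n := fun {m n} h =>
    (by rw [S_succ]; exact le_add_of_nonneg_left (S_nonneg m) : f m ≤ S (m + 1)).trans (S_mono h)
  have hsum : Summable fun n => (1 / 2 : ℝ) ^ n • f n := by
    refine Summable.of_norm_bounded summable_geometric_two fun n => ?_
    rw [norm_smul, Real.norm_of_nonneg (by positivity)]
    exact mul_le_of_le_one_right (by positivity) (hf n).2.1
  set y := ∑' n, (1 / 2 : ℝ) ^ n • f n with hy
  have term_nonneg : ∀ n, 0 ≤ (1 / 2 : ℝ) ^ n • f n := fun n =>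
    smul_nonneg (by positivity) (hf n).1
  have y_nonneg : 0 ≤ y := tsum_nonneg term_nonneg
  have le_y : ∀ n, (1 / 2 : ℝ) ^ n • f n ≤ y := fun n =>
    hsum.le_tsum n fun i _ => term_nonneg i
  -- Subtracting `4 ^ n • S n` separates `v n` from its predecessors; subtracting a multiple of `y`,
  -- which dominates every `2⁻ⁿ • f n`, separates it from its successors. For `m < n` the two
  -- factors multiply to `4 ^ n * 2⁻ᵐ * 2⁻ⁿ ≥ 1`. The `y` correction costs only `2⁻ⁿ * |φ| y`, which
  -- vanishes in the limit.
  set v : ℕ → F := fun n => (f n - (4 : ℝ) ^ n • S n - (1 / 2 : ℝ) ^ n • y)⁺ with hv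
  have v_nonneg : ∀ n, 0 ≤ v n := fun n => posPart_nonneg _
  have hdis : ∀ {m n}, m < n → v n ⊓ v m = 0 := by
    intro m n hmn
    refine inf_eq_zero_of_le (v_nonneg n) (v_nonneg m) (posPart_mono ?_) (posPart_mono ?_)
      (posPart_sub_smul_inf_eq_zero (x := f n) (y := f m) (a := 4 ^ n)
        (b := (1 / 2) ^ m * (1 / 2) ^ n) (one_le_pow₀ (by norm_num)) ?_ (hf n).1)
    · refine (sub_le_self _ (smul_nonneg (by positivity) y_nonneg)).trans ?_
      exact sub_le_sub_left (smul_le_smul_of_nonneg_left (f_le_S hmn) (by positivity)) _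
    · rw [mul_smul]
      exact sub_le_sub (sub_le_self _ (smul_nonneg (by positivity) (S_nonneg m)))
        (smul_le_smul_of_nonneg_left (le_y n) (by positivity))
    · have h4 : (4 : ℝ) ^ n = 2 ^ n * 2 ^ n := by rw [← mul_pow]; norm_num
      have e : (4 : ℝ) ^ n * ((1 / 2) ^ m * (1 / 2) ^ n) = 2 ^ n * (1 / 2) ^ m := by
        rw [h4, one_div, inv_pow, inv_pow]
        field_simp
      rw [e, one_div, inv_pow, ← div_eq_mul_inv, one_le_div (by positivity)]
      exact pow_le_pow_right₀ (by norm_num) hmn.le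
  have v_disj : DisjointSeq v := by
    intro m n hmn
    rw [abs_of_nonneg (v_nonneg m), abs_of_nonneg (v_nonneg n)]
    rcases hmn.lt_or_gt with h | h
    · rw [inf_comm]; exact hdis h
    · exact hdis h
  have v_le : ∀ n, v n ≤ f n := fun n => sup_le
    ((sub_le_self _ (smul_nonneg (by positivity) y_nonneg)).trans
      (sub_le_self _ (smul_nonneg (by positivity) (S_nonneg n)))) (hf n).1
  have v_bdd : Bornology.IsBounded (Set.range v) := isBounded_iff_forall_norm_le.2 ⟨1, by
    rintro _ ⟨n, rfl⟩
    exact (norm_le_norm_of_nonneg_of_le (v_nonneg n) (v_le n)).trans (hf n).2.1⟩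
  have hlim := hφ v v_disj v_bdd
  have hlim' : Tendsto (fun n => |φ| |v n| + (1 / 2 : ℝ) ^ n * |φ| y) atTop (𝓝 (0 + 0 * |φ| y)) :=
    hlim.add ((tendsto_pow_atTop_nhds_zero_of_lt_one (by norm_num) (by norm_num)).mul_const _)
  have hge : ∀ n, ε ≤ |φ| |v n| + (1 / 2 : ℝ) ^ n * |φ| y := by
    intro n
    refine (hf n).2.2.le.trans ?_
    have h : (f n - (4 : ℝ) ^ n • S n)⁺ ≤ v n + (1 / 2 : ℝ) ^ n • y := by
      refine sup_le ?_ (add_nonneg (v_nonneg n) (smul_nonneg (by positivity) y_nonneg))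
      rw [← sub_le_iff_le_add]
      exact le_posPart _
    have := dual_apply_mono (abs_nonneg φ) h
    rwa [map_add, map_smul, smul_eq_mul, ← abs_of_nonneg (v_nonneg n)] at this
  have := ge_of_tendsto' hlim' hge
  simp at this
  linarith

/-- Fix `φ₀` in `D` and its almost order bound `u`, then `φ₁` in `D` small at `u`. A common lower
bound `φ` in `D` satisfies `φ f ≤ φ₁ u + φ₀ (f - u)⁺` for positive `f` in the unit ball. -/
theorem orderContinuousNormOn_nullOnDisjointIdeal :
    OrderContinuousNormOn (nullOnDisjointIdeal F) := by
  intro D hne hdir hglb ε hε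
  have hpos : ∀ φ ∈ D, (0 : StrongDual ℝ F) ≤ φ := fun φ hφ => hglb.1 hφ
  obtain ⟨ψ, hψ⟩ := exists_dual_pointwise_inf (D := Subtype.val '' D) (hne.image _)
    (by
      rintro _ ⟨φ, hφ, rfl⟩ _ ⟨χ, hχ, rfl⟩
      obtain ⟨θ, hθ, h₁, h₂⟩ := hdir φ hφ χ hχ
      exact ⟨θ, ⟨θ, hθ, rfl⟩, h₁, h₂⟩)
    (by rintro _ ⟨φ, hφ, rfl⟩; exact hpos φ hφ)
  have ψ_le : ∀ φ ∈ D, ψ ≤ φ := fun φ hφ f hf => (hψ f hf).1 ⟨φ, ⟨φ, hφ, rfl⟩, rfl⟩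
  have ψ_nonneg : 0 ≤ ψ := fun f hf => (hψ f hf).2 (by
    rintro _ ⟨_, ⟨φ, hφ, rfl⟩, rfl⟩
    exact dual_apply_nonneg (hpos φ hφ) hf)
  obtain ⟨φ₀, hφ₀⟩ := hne
  -- The infimum in `hglb` is taken inside the ideal, so `ψ` must be placed there before it can be
  -- compared with `0`.
  have ψ_mem : ψ ∈ nullOnDisjointIdeal F := isSolid_nullOnDisjointIdeal φ₀.2 (by
    rw [abs_of_nonneg ψ_nonneg, abs_of_nonneg (hpos φ₀ hφ₀)]
    exact ψ_le φ₀ hφ₀)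
  have ψ_le_zero : ψ ≤ 0 :=
    hglb.2 (show (⟨ψ, ψ_mem⟩ : nullOnDisjointIdeal F) ∈ lowerBounds D from fun φ hφ => ψ_le φ hφ)
  obtain ⟨u, hu, hφu⟩ := NullOnDisjoint.exists_posPart_le φ₀.2 (by positivity : 0 < ε / 4)
  rw [abs_of_nonneg (hpos φ₀ hφ₀)] at hφu
  obtain ⟨_, ⟨_, ⟨φ₁, hφ₁, rfl⟩, rfl⟩, -, h₁⟩ := (hψ u hu).exists_between
    (lt_of_le_of_lt (ψ_le_zero u hu) (by simpa using (by positivity : 0 < ε / 4)) :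
      ψ u < ε / 4)
  obtain ⟨φ, hφ, hle₀, hle₁⟩ := hdir φ₀ hφ₀ φ₁ hφ₁
  refine ⟨φ, hφ, ?_⟩
  have hball : ∀ f : F, 0 ≤ f → ‖f‖ ≤ 1 → (φ : StrongDual ℝ F) f ≤ ε / 2 := by
    intro f hf hf1
    have h : f ≤ u + (f - u)⁺ := by
      rw [← sub_le_iff_le_add']; exact le_posPart _
    have a := dual_apply_mono (hpos φ hφ) h
    rw [map_add] at a
    have b : (φ : StrongDual ℝ F) u ≤ (φ₁ : StrongDual ℝ F) u := hle₁ u hu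
    have c : (φ : StrongDual ℝ F) (f - u)⁺ ≤ (φ₀ : StrongDual ℝ F) (f - u)⁺ :=
      hle₀ _ (posPart_nonneg _)
    have d := hφu f hf hf1
    have e : (φ₁ : StrongDual ℝ F) u < ε / 4 := h₁
    linarith
  refine lt_of_le_of_lt (dual_norm_le_of_nonneg (hpos φ hφ) (by positivity : 0 ≤ ε / 2)
    fun f hf => ?_) (half_lt_self hε)
  rcases eq_or_ne f 0 with rfl | hne
  · simp
  · have n0 : 0 < ‖f‖ := norm_pos_iff.2 hne
    have := hball (‖f‖⁻¹ • f) (smul_nonneg (by positivity) hf)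
      (by rw [norm_smul, norm_inv, norm_norm, inv_mul_cancel₀ n0.ne'])
    rwa [map_smul, smul_eq_mul, inv_mul_le_iff₀ n0, mul_comm] at this

theorem mem_orderContinuousPart_dual_iff (μ : StrongDual ℝ F) :
    μ ∈ orderContinuousPart (StrongDual ℝ F) ↔ NullOnDisjoint μ :=
  ⟨nullOnDisjoint_of_mem_orderContinuousPart, fun h =>
    ⟨nullOnDisjointIdeal F, isSolid_nullOnDisjointIdeal,
      orderContinuousNormOn_nullOnDisjointIdeal, h⟩⟩

end AlmostOrderBounded

/-! ### The equivalences for an operator with `‖J f‖ = |μ| |f|` -/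

section Characterization

variable {F : Type u} [NormedAddCommGroup F] [Lattice F] [HasSolidNorm F] [IsOrderedAddMonoid F]
  [NormedSpace ℝ F] [IsOrderedModule ℝ F]

theorem boundedlyExhaustive_alTopology_iff (μ : StrongDual ℝ F) :
    BoundedlyExhaustive (alTopology μ) ↔ NullOnDisjoint μ := by
  have key : ∀ f : ℕ → F, Tendsto f atTop (@nhds F (alTopology μ) 0) ↔
      Tendsto (fun n => |μ| |f n|) atTop (𝓝 0) := fun f =>
    @tendsto_zero_iff_norm_tendsto_zero ℕ F
      (alSeminorm μ).toSeminormedAddCommGroup.toSeminormedAddGroup f atTop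
  simp only [BoundedlyExhaustive, NullOnDisjoint, key]

theorem exists_disjointSeq_of_not_nullOnDisjoint {μ : StrongDual ℝ F} (h : ¬ NullOnDisjoint μ) :
    ∃ (f : ℕ → F) (δ : ℝ), DisjointSeq f ∧ (∀ n, ‖f n‖ = 1) ∧ 0 < δ ∧ ∀ n, δ ≤ |μ| |f n| := by
  simp only [NullOnDisjoint, not_forall] at h
  obtain ⟨f, hf, hb, hlim⟩ := h
  rw [Metric.tendsto_atTop] at hlim
  push Not at hlim
  obtain ⟨δ, hδ, hfreq⟩ := hlim
  obtain ⟨k, hk, hkδ⟩ := extraction_of_frequently_atTop (P := fun n => δ ≤ |μ| |f n|)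
    (frequently_atTop.2 fun N => by
      obtain ⟨n, hn, h⟩ := hfreq N
      refine ⟨n, hn, ?_⟩
      rwa [Real.dist_0_eq_abs,
        abs_of_nonneg (dual_apply_nonneg (abs_nonneg μ) (abs_nonneg _))] at h)
  obtain ⟨C, hC⟩ := hb.exists_norm_le
  have hC' : ∀ n, ‖f (k n)‖ ≤ C := fun n => hC _ ⟨_, rfl⟩
  have hpos : ∀ n, 0 < ‖f (k n)‖ := fun n => norm_pos_iff.2 fun h => by
    have := hkδ n
    simp only [h, abs_zero, map_zero] at this
    linarith
  have hC0 : 0 < C := (hpos 0).trans_le (hC' 0)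
  -- Normalizing divides by at most `C`, whence the constant.
  refine ⟨fun n => ‖f (k n)‖⁻¹ • f (k n), C⁻¹ * δ,
    (hf.comp hk.injective).smul fun n => ‖f (k n)‖⁻¹, fun n => ?_, by positivity, fun n => ?_⟩
  · rw [norm_smul, norm_inv, norm_norm, inv_mul_cancel₀ (hpos n).ne']
  · rw [abs_real_smul, map_smul, smul_eq_mul, abs_of_nonneg (inv_nonneg.2 (norm_nonneg _))]
    exact mul_le_mul (inv_anti₀ (hpos n) (hC' n)) (hkδ n) hδ.le
      (inv_nonneg.2 (norm_nonneg _))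

variable {Y : Type*} [NormedAddCommGroup Y] [NormedSpace ℝ Y]

theorem NullOnDisjoint.tendsto_norm {μ : StrongDual ℝ F} (h : NullOnDisjoint μ) {J : F →L[ℝ] Y}
    (hJ : ∀ f, ‖J f‖ = |μ| |f|) {f : ℕ → F} (hf : DisjointSeq f)
    (hb : Bornology.IsBounded (Set.range f)) : Tendsto (fun n => ‖J (f n)‖) atTop (𝓝 0) := by
  simp_rw [hJ]
  exact h f hf hb

/-- `ℓ₁` behaviour: `|μ|` is additive on the modulus of a disjoint sum, giving at least `δ * ∑ |a
i|`, while the triangle inequality bounds the norm by `∑ |a i|`. -/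
theorem le_norm_of_mem_closedSpan_of_le {μ : StrongDual ℝ F} {J : F →L[ℝ] Y}
    (hJ : ∀ f, ‖J f‖ = |μ| |f|) {f : ℕ → F} (hf : DisjointSeq f) (h1 : ∀ n, ‖f n‖ = 1) {δ : ℝ}
    (hδ : 0 < δ) (h : ∀ n, δ ≤ |μ| |f n|) {x : F} (hx : x ∈ closedSpan f) :
    δ * ‖x‖ ≤ ‖J x‖ := by
  refine le_norm_of_mem_closedSpan J (fun s a => ?_) hx
  rw [hJ, hf.abs_sum, map_sum]
  calc δ * ‖∑ i ∈ s, a i • f i‖ ≤ δ * ∑ i ∈ s, |a i| := by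
        gcongr
        refine (norm_sum_le _ _).trans (Finset.sum_le_sum fun i _ => ?_)
        rw [norm_smul, h1, mul_one, Real.norm_eq_abs]
    _ = ∑ i ∈ s, |a i| * δ := by rw [mul_comm, Finset.sum_mul]
    _ ≤ _ := Finset.sum_le_sum fun i _ => by
        rw [map_smul, smul_eq_mul]
        exact mul_le_mul_of_nonneg_left (h i) (abs_nonneg _)

theorem NullOnDisjoint.dss {μ : StrongDual ℝ F} (h : NullOnDisjoint μ) {J : F →L[ℝ] Y}
    (hJ : ∀ f, ‖J f‖ = |μ| |f|) : DSS J := by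
  rintro f hf h0 ⟨c, hc, hbd⟩
  have h1 : ∀ n, ‖‖f n‖⁻¹ • f n‖ = 1 := fun n => by
    rw [norm_smul, norm_inv, norm_norm, inv_mul_cancel₀ (norm_ne_zero_iff.2 (h0 n))]
  have hlim := h.tendsto_norm hJ (hf.smul fun n => ‖f n‖⁻¹)
    (isBounded_iff_forall_norm_le.2 ⟨1, by rintro _ ⟨n, rfl⟩; exact (h1 n).le⟩)
  refine absurd (ge_of_tendsto' hlim (b := c) fun n => ?_) (not_le.2 hc)
  have := hbd ⟨‖f n‖⁻¹ • f n, Submodule.smul_mem _ _ (mem_closedSpan f n)⟩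
  simpa [h1 n] using this

/-- The quotient map kills `e n`, so `‖J (e n)‖ ≥ c`; yet `J (e n)` is asymptotic to `J (f n)`,
which tends to zero. -/
theorem NullOnDisjoint.dispersed {μ : StrongDual ℝ F} (h : NullOnDisjoint μ) {J : F →L[ℝ] Y}
    (hJ : ∀ f, ‖J f‖ = |μ| |f|) (E : Submodule ℝ F) (hE : BoundedBelow (E.mkQL.prod J)) :
    Dispersed E := by
  rintro ⟨e, f, he, hf, hlim⟩
  obtain ⟨c, hc, hbd⟩ := hE
  have hfe : Tendsto (fun n => f n - e n) atTop (𝓝 0) := tendsto_zero_iff_norm_tendsto_zero.2 hlim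
  have hb : Bornology.IsBounded (Set.range f) := by
    obtain ⟨C, hC⟩ := hlim.bddAbove_range
    refine isBounded_iff_forall_norm_le.2 ⟨C + 1, ?_⟩
    rintro _ ⟨n, rfl⟩
    calc ‖f n‖ = ‖(f n - e n) + e n‖ := by rw [sub_add_cancel]
      _ ≤ ‖f n - e n‖ + ‖e n‖ := norm_add_le _ _
      _ ≤ C + 1 := add_le_add (hC ⟨n, rfl⟩) (he n).2.le
  have h₁ : Tendsto (fun n => ‖J (f n)‖ + ‖J (f n - e n)‖) atTop (𝓝 0) := by
    simpa using (h.tendsto_norm hJ hf hb).add ((J.continuous.tendsto 0).comp hfe).norm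
  refine absurd (ge_of_tendsto' h₁ (b := c) fun n => ?_) (not_le.2 hc)
  have hq : (E.mkQL.prod J) (e n) = (0, J (e n)) :=
    Prod.ext ((Submodule.Quotient.mk_eq_zero E).2 (he n).1) rfl
  have := hbd (e n)
  rw [(he n).2, mul_one, hq, Prod.norm_def, norm_zero, max_eq_right (norm_nonneg _)] at this
  refine this.trans ?_
  calc ‖J (e n)‖ = ‖J (f n) - J (f n - e n)‖ := by rw [map_sub, sub_sub_cancel]
    _ ≤ _ := norm_sub_le _ _

/-- On the span of a sparse enough normalized subsequence `J` has norm at most `c / 2`, so `T` alone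
must provide the lower bound `c`. -/
theorem NullOnDisjoint.dns {μ : StrongDual ℝ F} (h : NullOnDisjoint μ) {J : F →L[ℝ] Y}
    (hJ : ∀ f, ‖J f‖ = |μ| |f|) {H : Type*} [NormedAddCommGroup H] [NormedSpace ℝ H]
    (T : F →L[ℝ] H) (hT : BoundedBelow (T.prod J)) : DNS T := by
  intro f hf h0 hss
  obtain ⟨c, hc, hbd⟩ := hT
  set g : ℕ → F := fun n => ‖f n‖⁻¹ • f n with hg
  have h1 : ∀ n, ‖g n‖ = 1 := fun n => by
    rw [hg, norm_smul, norm_inv, norm_norm, inv_mul_cancel₀ (norm_ne_zero_iff.2 (h0 n))]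
  have hgd : DisjointSeq g := hf.smul fun n => ‖f n‖⁻¹
  have hlim := h.tendsto_norm hJ hgd
    (isBounded_iff_forall_norm_le.2 ⟨1, by rintro _ ⟨n, rfl⟩; exact (h1 n).le⟩)
  -- Coefficients are at most `‖x‖`, so these bounds sum to `c / 2 * ‖x‖`.
  obtain ⟨k, hk, hkJ⟩ := extraction_forall_of_eventually'
    (P := fun n i => ‖J (g i)‖ ≤ c / 4 * (1 / 2) ^ n) fun n => by
      obtain ⟨N, hN⟩ := eventually_atTop.1
        (hlim.eventually_le_const (by positivity : 0 < c / 4 * (1 / 2) ^ n))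
      exact ⟨N, hN⟩
  have hkd : DisjointSeq (g ∘ k) := hgd.comp hk.injective
  have hsmall : ∀ x ∈ Submodule.span ℝ (Set.range (g ∘ k)), ‖J x‖ ≤ c / 2 * ‖x‖ := by
    intro x hx
    obtain ⟨s, a, rfl⟩ := exists_eq_sum_of_mem_span hx
    set x := ∑ i ∈ s, a i • (g ∘ k) i with hxdef
    calc ‖J x‖ ≤ ∑ i ∈ s, ‖x‖ * (c / 4 * (1 / 2) ^ i) := by
          rw [hxdef, map_sum]
          refine (norm_sum_le _ _).trans (Finset.sum_le_sum fun i hi => ?_)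
          rw [map_smul, norm_smul, Real.norm_eq_abs]
          refine mul_le_mul ?_ (hkJ i) (norm_nonneg _) (norm_nonneg _)
          have := hkd.abs_mul_norm_le s a hi
          rwa [Function.comp_apply, h1, mul_one] at this
      _ = ‖x‖ * (c / 4) * ∑ i ∈ s, (1 / 2 : ℝ) ^ i := by
          rw [Finset.mul_sum]; exact Finset.sum_congr rfl fun i _ => by ring
      _ ≤ ‖x‖ * (c / 4) * 2 := by
          refine mul_le_mul_of_nonneg_left ?_ (by positivity)
          exact (summable_geometric_two.sum_le_tsum s fun i _ => by positivity).trans_eq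
            tsum_geometric_two
      _ = c / 2 * ‖x‖ := by ring
  let w : ℕ → closedSpan f := fun n =>
    ⟨g (k n), Submodule.smul_mem _ _ (mem_closedSpan f (k n))⟩
  have hw : LinearIndependent ℝ w := LinearIndependent.of_comp (closedSpan f).subtype
    (hkd.linearIndependent fun n h => by
      have := h1 (k n)
      rw [Function.comp_apply] at h
      rw [h, norm_zero] at this
      exact zero_ne_one this)
  -- The algebraic span suffices, as `StrictlySingular` ranges over all subspaces, closed or not.
  refine hss (Submodule.span ℝ (Set.range w)) (fun hfin => ?_) ⟨c, hc, fun x => ?_⟩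
  · exact not_finite_iff_infinite.2 inferInstance (linearIndependent_span hw).finite
  · have hx : ((x : closedSpan f) : F) ∈ Submodule.span ℝ (Set.range (g ∘ k)) := by
      have := Submodule.mem_map_of_mem (f := (closedSpan f).subtype) x.2
      rw [Submodule.map_span, ← Set.range_comp] at this
      exact this
    have h₁ := hbd ((x : closedSpan f) : F)
    have h₂ := hsmall _ hx
    change c * ‖((x : closedSpan f) : F)‖ ≤ ‖T ((x : closedSpan f) : F)‖
    rw [ContinuousLinearMap.prod_apply, Prod.norm_def] at h₁
    rcases le_max_iff.1 h₁ with h₃ | h₃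
    · exact h₃
    · have : ‖((x : closedSpan f) : F)‖ = 0 := by
        have := norm_nonneg ((x : closedSpan f) : F)
        nlinarith
      rw [this, mul_zero]
      exact norm_nonneg _

/-- Let `m` be a nearly norm-minimal representative of the class of `x`. Then `x - m ∈ E`, so `‖x‖ ≤
‖m‖ + δ⁻¹ * ‖J (x - m)‖`, and `‖m‖` is nearly the quotient norm. -/
theorem boundedBelow_mkQL_prod (J : F →L[ℝ] Y) (E : Submodule ℝ F) {δ : ℝ} (hδ : 0 < δ)
    (h : ∀ x ∈ E, δ * ‖x‖ ≤ ‖J x‖) : BoundedBelow (E.mkQL.prod J) := by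
  set K := 1 + δ⁻¹ * ‖J‖ with hK
  have hK0 : 0 < K := by positivity
  have key : ∀ x : F, ‖x‖ ≤ K * ‖E.mkQL x‖ + δ⁻¹ * ‖J x‖ := by
    intro x
    refine le_of_forall_pos_le_add fun ε hε => ?_
    obtain ⟨m, hm, hm'⟩ := Submodule.Quotient.norm_mk_lt (S := E) (E.mkQL x)
      (by positivity : 0 < ε / K)
    have hE : x - m ∈ E := by
      rw [← Submodule.Quotient.mk_eq_zero, Submodule.Quotient.mk_sub, hm]
      exact sub_self _
    have h₁ : ‖x - m‖ ≤ δ⁻¹ * ‖J (x - m)‖ := by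
      rw [inv_mul_eq_div, le_div_iff₀ hδ, mul_comm]; exact h _ hE
    have h₂ : ‖J (x - m)‖ ≤ ‖J x‖ + ‖J‖ * ‖m‖ := by
      rw [map_sub]
      exact (norm_sub_le _ _).trans (add_le_add_right (J.le_opNorm m) _)
    calc ‖x‖ = ‖m + (x - m)‖ := by rw [add_sub_cancel]
      _ ≤ ‖m‖ + ‖x - m‖ := norm_add_le _ _
      _ ≤ ‖m‖ + δ⁻¹ * (‖J x‖ + ‖J‖ * ‖m‖) := by
        gcongr
        exact h₁.trans (mul_le_mul_of_nonneg_left h₂ (by positivity))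
      _ = K * ‖m‖ + δ⁻¹ * ‖J x‖ := by rw [hK]; ring
      _ ≤ K * (‖E.mkQL x‖ + ε / K) + δ⁻¹ * ‖J x‖ := by gcongr
      _ = K * ‖E.mkQL x‖ + δ⁻¹ * ‖J x‖ + ε := by field_simp; ring
  have hs : 0 < K + δ⁻¹ := by positivity
  refine ⟨(K + δ⁻¹)⁻¹, by positivity, fun x => ?_⟩
  rw [inv_mul_le_iff₀ hs, ContinuousLinearMap.prod_apply, Prod.norm_def, add_mul]
  exact (key x).trans (add_le_add (mul_le_mul_of_nonneg_left (le_max_left _ _) hK0.le)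
    (mul_le_mul_of_nonneg_left (le_max_right _ _) (by positivity)))

/-- The characterizations of the order continuous part of the dual in terms of an operator
`J` with `‖J f‖ = |μ| |f|`. -/
theorem orderContinuousPart_dual_tfae [CompleteSpace F] (μ : StrongDual ℝ F) (J : F →L[ℝ] Y)
    (hJ : ∀ f, ‖J f‖ = |μ| |f|) :
    List.TFAE
      [μ ∈ orderContinuousPart (StrongDual ℝ F),
       BoundedlyExhaustive (alTopology μ),
       ∀ (H : Type u) [NormedAddCommGroup H] [NormedSpace ℝ H] [CompleteSpace H] (T : F →L[ℝ] H),
        BoundedBelow (T.prod J) → DNS T,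
       ∀ E : Submodule ℝ F, IsClosed (E : Set F) →
        BoundedBelow (E.mkQL.prod J) → Dispersed E,
       DSS J] := by
  rw [mem_orderContinuousPart_dual_iff, boundedlyExhaustive_alTopology_iff]
  tfae_have 1 ↔ 2 := Iff.rfl
  tfae_have 2 → 3 := fun h H _ _ _ T hT => h.dns hJ T hT
  tfae_have 2 → 4 := fun h E _ hE => h.dispersed hJ E hE
  tfae_have 2 → 5 := fun h => h.dss hJ
  tfae_have 3 → 2 := by
    intro h
    by_contra hnot
    obtain ⟨f, δ, hf, h1, hδ, hle⟩ := exists_disjointSeq_of_not_nullOnDisjoint hnot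
    have h0 : ∀ n, f n ≠ 0 := fun n => norm_ne_zero_iff.1 (by rw [h1]; exact one_ne_zero)
    have : IsClosed (closedSpan f : Set F) := Submodule.isClosed_topologicalClosure _
    -- The quotient map vanishes on `closedSpan f`, so its restriction is zero and is bounded below
    -- only on the zero subspace.
    refine h (F ⧸ closedSpan f) (closedSpan f).mkQL (boundedBelow_mkQL_prod J _ hδ fun x hx =>
      le_norm_of_mem_closedSpan_of_le hJ hf h1 hδ hle hx) f hf h0 ?_
    rintro G hG ⟨c, hc, hbd⟩
    refine hG ?_
    have hzero : ∀ x : G, x = 0 := fun x => by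
      have hx := hbd x
      have e : ((closedSpan f).mkQL.comp (closedSpan f).subtypeL).comp G.subtypeL x = 0 :=
        (Submodule.Quotient.mk_eq_zero _).2 (x : closedSpan f).2
      rw [e, norm_zero] at hx
      exact norm_le_zero_iff.1 (nonpos_of_mul_nonpos_right hx hc)
    have : Subsingleton G := ⟨fun x y => (hzero x).trans (hzero y).symm⟩
    infer_instance
  tfae_have 4 → 2 := by
    intro h
    by_contra hnot
    obtain ⟨f, δ, hf, h1, hδ, hle⟩ := exists_disjointSeq_of_not_nullOnDisjoint hnot
    refine h (closedSpan f) (Submodule.isClosed_topologicalClosure _)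
      (boundedBelow_mkQL_prod J _ hδ fun x hx =>
        le_norm_of_mem_closedSpan_of_le hJ hf h1 hδ hle hx)
      ⟨f, f, fun n => ⟨mem_closedSpan f n, h1 n⟩, hf, by simp⟩
  tfae_have 5 → 2 := by
    intro h
    by_contra hnot
    obtain ⟨f, δ, hf, h1, hδ, hle⟩ := exists_disjointSeq_of_not_nullOnDisjoint hnot
    exact h f hf (fun n => norm_ne_zero_iff.1 (by rw [h1]; exact one_ne_zero))
      ⟨δ, hδ, fun x => le_norm_of_mem_closedSpan_of_le hJ hf h1 hδ hle x.2⟩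
  tfae_finish

end Characterization

/-- The `L₁` norm is the integral of `|J f| = J |f|`; this brings concrete `L₁` representations
under the general equivalence. -/
theorem norm_eq_of_abs_eq_of_integral_eq {F : Type u} [NormedAddCommGroup F] [Lattice F]
    [NormedSpace ℝ F] {Ω : Type v} [MeasurableSpace Ω] {m : Measure Ω} (J : F →L[ℝ] Lp ℝ 1 m)
    (φ : F → ℝ) (habs : ∀ f : F, J |f| = |J f|) (hint : ∀ f : F, ∫ ω, J f ω ∂m = φ f) (f : F) :
    ‖J f‖ = φ |f| := by
  rw [← hint, habs, L1.norm_eq_integral_norm]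
  refine integral_congr_ae ?_
  filter_upwards [Lp.coeFn_abs (J f)] with ω hω
  rw [hω, Real.norm_eq_abs]

end BanachLattice

theorem mainTheorem9 {F : Type u} [NormedAddCommGroup F] [Lattice F] [HasSolidNorm F]
    [IsOrderedAddMonoid F] [NormedSpace ℝ F] [IsOrderedModule ℝ F] [CompleteSpace F]
    (μ : StrongDual ℝ F) :
    List.TFAE
      [μ ∈ BanachLattice.orderContinuousPart (StrongDual ℝ F),
       BanachLattice.BoundedlyExhaustive (BanachLattice.alTopology μ),
       ∀ (H : Type u) [NormedAddCommGroup H] [NormedSpace ℝ H] [CompleteSpace H] (T : F →L[ℝ] H),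
        BanachLattice.BoundedBelow (T.prod (BanachLattice.J μ)) → BanachLattice.DNS T,
       ∀ E : Submodule ℝ F, IsClosed (E : Set F) →
        BanachLattice.BoundedBelow (E.mkQL.prod (BanachLattice.J μ)) → BanachLattice.Dispersed E,
       BanachLattice.DSS (BanachLattice.J μ)] ∧
    ∀ {Ω : Type v} [MeasurableSpace Ω] (m : Measure Ω) (J : F →L[ℝ] Lp ℝ 1 m),
      (∀ f : F, J |f| = |J f|) → (∀ f : F, ∫ ω, J f ω ∂m = |μ| f) →
      List.TFAE
        [μ ∈ BanachLattice.orderContinuousPart (StrongDual ℝ F),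
         BanachLattice.BoundedlyExhaustive (BanachLattice.alTopology μ),
         ∀ (H : Type u) [NormedAddCommGroup H] [NormedSpace ℝ H] [CompleteSpace H]
          (T : F →L[ℝ] H), BanachLattice.BoundedBelow (T.prod J) → BanachLattice.DNS T,
         ∀ E : Submodule ℝ F, IsClosed (E : Set F) →
          BanachLattice.BoundedBelow (E.mkQL.prod J) → BanachLattice.Dispersed E,
         BanachLattice.DSS J] := by
  refine ⟨BanachLattice.orderContinuousPart_dual_tfae μ _ (BanachLattice.norm_J μ), ?_⟩
  intro Ω _ m J habs hint
  exact BanachLattice.orderContinuousPart_dual_tfae μ J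
    (BanachLattice.norm_eq_of_abs_eq_of_integral_eq J _ habs hint)
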